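/- Let $J\in C(\mathbb R^N,\mathbb R)$ be nonnegative, spherically symmetric and radially decreasing (not necessarily strictly), with $J(0)>0$ and $\int_{\mathbb R^N}J(x)\,dx=1$. For a bounded measurable set $E\subset\mathbb R^N$ let $W_E=\{u\in L^2(\mathbb R^N): u=0 \text{ a.e. in } \mathbb R^N\setminus E\}$ and let $\mathcal B_E:W_E\to W_E$ be the operator $$\mathcal B_E u(x)=u(x)-\int_E J(x-y)\,u(y)\,dy,\qquad x\in E ;$$ its first eigenvalue $\lambda_1(E)$ is its smallest eigenvalue. Let $\Omega\subset\mathbb R^N$ be a nonempty bounded open set, let $Q=(0,l_1)\times\dots\times(0,l_N)$ with $l_1,\dots,l_N>0$, and let $A\subset\overline Q$ be a measurable set (for example an open subset of $Q$, or the closure of one) with $|Q\setminus A|\neq 0$. For $\varepsilon>0$ let $$\Omega^\varepsilon=\Omega\setminus A^\varepsilon,\qquad A^\varepsilon=\Omega\cap\bigcup_{k\in\mathbb Z^N}\varepsilon\,(kl+A),\qquad kl=(k_1l_1,\dots,k_Nl_N).$$ Then $\mathcal B_\Omega$ and, for all sufficiently small $\varepsilon>0$, $\mathcal B_{\Omega^\varepsilon}$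 have a first eigenvalue, the limit $\beta_1=\lim_{\varepsilon\to0^+}\lambda_1(\Omega^\varepsilon)$ exists, and $\beta_1$ is the first eigenvalue of $\mathcal B_\Omega$ if and only if $|A|=0$. -/

import Mathlib

open MeasureTheory Filter Topology

/-- Hypothesis **(H)** on the kernel: continuous, nonnegative, spherically symmetric, radially
decreasing (in the weak sense), positive at the origin, and of total mass one. -/
structure KernelH {N : ℕ} (J : EuclideanSpace ℝ (Fin N) → ℝ) : Prop where
  continuous : Continuous J
  nonneg : ∀ x, 0 ≤ J x
  radial : ∀ x y, ‖x‖ = ‖y‖ → J x = J y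
  decreasing : ∀ x y, ‖x‖ ≤ ‖y‖ → J y ≤ J x
  pos_zero : 0 < J 0
  integrable : Integrable J volume
  integral_eq_one : ∫ x, J x = 1

/-- The space `W_Ω` of all `u ∈ L²(ℝᴺ)` that vanish (almost everywhere) outside `Ω`. -/
def W {N : ℕ} (Ω : Set (EuclideanSpace ℝ (Fin N))) :
    Submodule ℝ (Lp ℝ 2 (volume : Measure (EuclideanSpace ℝ (Fin N)))) where
  carrier := {u | ∀ᵐ x, x ∉ Ω → u x = 0}
  zero_mem' := by
    filter_upwards [Lp.coeFn_zero ℝ 2 (volume : Measure (EuclideanSpace ℝ (Fin N)))] with x hx _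
    exact hx
  add_mem' := by
    intro u v hu hv
    change ∀ᵐ x, x ∉ Ω → (u + v) x = 0
    filter_upwards [Lp.coeFn_add u v, hu, hv] with x hx h1 h2 hΩ
    rw [hx, Pi.add_apply, h1 hΩ, h2 hΩ, add_zero]
  smul_mem' := by
    intro c u hu
    change ∀ᵐ x, x ∉ Ω → (c • u) x = 0
    filter_upwards [Lp.coeFn_smul c u, hu] with x hx h1 hΩ
    rw [hx, Pi.smul_apply, h1 hΩ, smul_zero]

/-- The nonlocal Dirichlet operator
`(𝓑_Ω u)(x) = u(x) - ∫_Ω J(x - y) u(y) dy` (a function to be considered for `x ∈ Ω`). -/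
noncomputable def nonlocalB {N : ℕ} (J : EuclideanSpace ℝ (Fin N) → ℝ)
    (Ω : Set (EuclideanSpace ℝ (Fin N))) (u : EuclideanSpace ℝ (Fin N) → ℝ) :
    EuclideanSpace ℝ (Fin N) → ℝ :=
  fun x => u x - ∫ y in Ω, J (x - y) * u y

/-- `lam` is an eigenvalue of `𝓑_Ω : W_Ω → W_Ω`: there is a nonzero `u ∈ W_Ω` with
`𝓑_Ω u = lam u` almost everywhere in `Ω`. -/
def IsEigenvalueB {N : ℕ} (J : EuclideanSpace ℝ (Fin N) → ℝ)
    (Ω : Set (EuclideanSpace ℝ (Fin N))) (lam : ℝ) : Prop :=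
  ∃ u ∈ W Ω, u ≠ 0 ∧ ∀ᵐ x, x ∈ Ω → nonlocalB J Ω u x = lam * u x

/-- `lam` is the first (that is, the smallest) eigenvalue of `𝓑_Ω`. -/
def IsFirstEigenvalueB {N : ℕ} (J : EuclideanSpace ℝ (Fin N) → ℝ)
    (Ω : Set (EuclideanSpace ℝ (Fin N))) (lam : ℝ) : Prop :=
  IsLeast {l : ℝ | IsEigenvalueB J Ω l} lam

/-- The open cell `Q = (0, l₁) × ⋯ × (0, l_N)`. -/
def cellQ {N : ℕ} (l : Fin N → ℝ) : Set (EuclideanSpace ℝ (Fin N)) :=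
  {x | ∀ i, 0 < x i ∧ x i < l i}

/-- The union `τ_ε(A)` of all the periodically distributed holes `ε (k l + A)`, `k ∈ ℤᴺ`, where
`k l = (k₁ l₁, …, k_N l_N)`. -/
def holes {N : ℕ} (l : Fin N → ℝ) (A : Set (EuclideanSpace ℝ (Fin N))) (ε : ℝ) :
    Set (EuclideanSpace ℝ (Fin N)) :=
  ⋃ k : Fin N → ℤ, (fun a => ε • (WithLp.toLp 2 (fun i => (k i : ℝ) * l i) + a)) '' A

/-- The perforated domain `Ω^ε = Ω ∖ A^ε`, where `A^ε = Ω ∩ τ_ε(A)`. -/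
def perforated {N : ℕ} (Ω : Set (EuclideanSpace ℝ (Fin N))) (l : Fin N → ℝ)
    (A : Set (EuclideanSpace ℝ (Fin N))) (ε : ℝ) : Set (EuclideanSpace ℝ (Fin N)) :=
  Ω \ (Ω ∩ holes l A ε)

/-! Write the operator on `E` as identity minus `K_E`, where `K_E` has kernel `J (x - y)` cut off to
`E × E`; on a bounded set it is compact and self-adjoint. When the supremum of its Rayleigh quotient
is positive it is attained, at an eigenvalue `μ`, and the first eigenvalue sought is `1 - μ`.

Let `K` be the operator of `Ω` and `P ε` multiplication by the indicator of `Ω^ε`. Then the operator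
of `Ω^ε` is the compression `P ε ∘ K ∘ P ε`. On `Ω` these indicators converge weakly to the constant
`θ = |Q \ A| / |Q| > 0` (`tendsto_setIntegral_compl_holes`). Compactness of `K` turns this into norm
convergence of `K P K` to `θ K²` (`eventually_norm_sub_le`), and then the top eigenvalue of the
compression tends to `θ μ` (`eventually_exists_isTopEigenvalue`).

Hence `β₁ = 1 - θ μ`. Since `μ > 0`, this equals `1 - μ` exactly when `θ = 1`, that is, when `A` is
null. -/

/-! ### Top eigenvalues of compact self-adjoint operators and of their compressions -/

section Rayleigh

variable {H : Type*} [NormedAddCommGroup H] [InnerProductSpace ℝ H]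

/-- `μ` is an eigenvalue of `T` that bounds its quadratic form from above. -/
def IsTopEigenvalue (T : H →L[ℝ] H) (μ : ℝ) : Prop :=
  (∃ u, u ≠ 0 ∧ T u = μ • u) ∧ ∀ v, inner ℝ (T v) v ≤ μ * ‖v‖ ^ 2

/-- Nonnegativity of the form at `C • u - S u`, with `C = ‖S‖ + 1` so that one may divide by `C`. It
shows that vectors on which the form nearly vanishes are nearly in the kernel. -/
theorem norm_sq_le_of_nonneg_form (S : H →L[ℝ] H) (hS : ∀ u v, inner ℝ (S u) v = inner ℝ u (S v))
    (hpos : ∀ v, 0 ≤ inner ℝ (S v) v) (u : H) :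
    ‖S u‖ ^ 2 ≤ (‖S‖ + 1) * inner ℝ (S u) u := by
  set C := ‖S‖ + 1 with hC
  have hC0 : 0 < C := by positivity
  have h1 := hpos (C • u - S u)
  have h2 : inner ℝ (S (S u)) (S u) ≤ C * ‖S u‖ ^ 2 := by
    calc inner ℝ (S (S u)) (S u) ≤ ‖S (S u)‖ * ‖S u‖ := real_inner_le_norm _ _
      _ ≤ (‖S‖ * ‖S u‖) * ‖S u‖ := by gcongr; exact S.le_opNorm _
      _ ≤ C * ‖S u‖ ^ 2 := by rw [hC]; nlinarith [sq_nonneg ‖S u‖]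
  have h3 : inner ℝ (S (C • u - S u)) (C • u - S u)
      = C ^ 2 * inner ℝ (S u) u - 2 * C * ‖S u‖ ^ 2 + inner ℝ (S (S u)) (S u) := by
    simp only [map_sub, map_smul, inner_sub_left, inner_sub_right, inner_smul_left,
      inner_smul_right, real_inner_self_eq_norm_sq, hS (S u) u]
    simp
    ring
  rw [h3] at h1
  have : 0 ≤ C * (C * inner ℝ (S u) u - ‖S u‖ ^ 2) := by nlinarith
  nlinarith [nonneg_of_mul_nonneg_right this hC0]

/-- Take a maximizing sequence of unit vectors. The form of `S = μ - T` is nonnegative and tends to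
zero along it, so `S (u n)` tends to zero. Compactness makes `T (u n)` converge along a subsequence,
and `μ > 0` then lets `u n` be recovered from `S (u n) + T (u n)`. -/
theorem exists_isTopEigenvalue (T : H →L[ℝ] H) (hT : IsCompactOperator T)
    (hs : ∀ u v, inner ℝ (T u) v = inner ℝ u (T v)) {v₀ : H} (hv₀ : 0 < inner ℝ (T v₀) v₀) :
    ∃ μ, 0 < μ ∧ IsTopEigenvalue T μ := by
  let R : Set ℝ := (fun v => inner ℝ (T v) v) '' Metric.sphere (0 : H) 1
  have hv0 : v₀ ≠ 0 := by rintro rfl; simp at hv₀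
  have hn0 : 0 < ‖v₀‖ := norm_pos_iff.2 hv0
  have hmem : ∀ v : H, v ≠ 0 → inner ℝ (T v) v / ‖v‖ ^ 2 ∈ R := by
    intro v hv
    have : ‖v‖ ≠ 0 := norm_ne_zero_iff.2 hv
    refine ⟨‖v‖⁻¹ • v, by simp [norm_smul, this], ?_⟩
    simp only [map_smul, inner_smul_left, inner_smul_right]
    simp
    field_simp
  have hbdd : BddAbove R := by
    refine ⟨‖T‖, ?_⟩
    rintro _ ⟨v, hv, rfl⟩
    have hv' : ‖v‖ = 1 := by simpa using hv
    calc inner ℝ (T v) v ≤ ‖T v‖ * ‖v‖ := real_inner_le_norm _ _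
      _ ≤ ‖T‖ := by have := T.le_opNorm v; rw [hv'] at this ⊢; linarith
  set μ := sSup R with hμ
  have hμ0 : 0 < μ := lt_of_lt_of_le (by positivity) (le_csSup hbdd (hmem v₀ hv0))
  have hle : ∀ v, inner ℝ (T v) v ≤ μ * ‖v‖ ^ 2 := by
    intro v
    rcases eq_or_ne v 0 with rfl | hv
    · simp
    · have h1 := le_csSup hbdd (hmem v hv)
      have : 0 < ‖v‖ := norm_pos_iff.2 hv
      rwa [div_le_iff₀ (by positivity)] at h1
  refine ⟨μ, hμ0, ?_, hle⟩
  obtain ⟨r, -, hr, hrR⟩ := exists_seq_tendsto_sSup (S := R) ⟨_, hmem v₀ hv0⟩ hbdd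
  choose u hu1 hu2 using hrR
  have hu1' : ∀ n, ‖u n‖ = 1 := fun n => by simpa using hu1 n
  let S : H →L[ℝ] H := μ • ContinuousLinearMap.id ℝ H - T
  have hSv : ∀ v, S v = μ • v - T v := fun v => by simp [S]
  have hSin : ∀ v, inner ℝ (S v) v = μ * ‖v‖ ^ 2 - inner ℝ (T v) v := by
    intro v
    rw [hSv, inner_sub_left, inner_smul_left, real_inner_self_eq_norm_sq]
    simp
  have hScs := norm_sq_le_of_nonneg_form S (fun u v => by
      rw [hSv, hSv, inner_sub_left, inner_sub_right, inner_smul_left, inner_smul_right, hs]; simp)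
      (fun v => by rw [hSin]; linarith [hle v])
  have hS0 : Tendsto (fun n => S (u n)) atTop (𝓝 0) := by
    rw [tendsto_zero_iff_norm_tendsto_zero]
    have h1 : Tendsto (fun n => (‖S‖ + 1) * (μ - r n)) atTop (𝓝 0) := by
      have := (tendsto_const_nhds (x := μ)).sub hr
      rw [show μ - sSup R = 0 from sub_self μ] at this
      simpa using this.const_mul (‖S‖ + 1)
    have h2 : Tendsto (fun n => ‖S (u n)‖ ^ 2) atTop (𝓝 0) := by
      refine squeeze_zero (fun n => by positivity) (fun n => ?_) h1
      have := hScs (u n)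
      rw [hSin, hu1'] at this
      have h4 : inner ℝ (T (u n)) (u n) = r n := hu2 n
      rw [h4] at this
      simpa using this
    have := h2.sqrt
    simpa using this
  obtain ⟨w, -, n, hn, hw⟩ := (hT.isCompact_closure_image_closedBall (M₁ := H) 1).tendsto_subseq
    (x := fun n => T (u n)) (fun n => subset_closure ⟨u n, by simp [hu1'], rfl⟩)
  have hlim : Tendsto (fun k => u (n k)) atTop (𝓝 (μ⁻¹ • w)) := by
    have h1 : Tendsto (fun k => μ⁻¹ • (S (u (n k)) + T (u (n k)))) atTop (𝓝 (μ⁻¹ • (0 + w))) :=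
      ((hS0.comp hn.tendsto_atTop).add hw).const_smul _
    rw [zero_add] at h1
    refine h1.congr fun k => ?_
    rw [hSv, sub_add_cancel, inv_smul_smul₀ hμ0.ne']
  refine ⟨μ⁻¹ • w, ?_, ?_⟩
  · have h1 := hlim.norm
    simp only [hu1'] at h1
    have h2 := tendsto_nhds_unique h1 tendsto_const_nhds
    exact norm_ne_zero_iff.1 (by rw [h2]; exact one_ne_zero)
  · have h1 := (S.continuous.tendsto _).comp hlim
    have h2 := tendsto_nhds_unique h1 (hS0.comp hn.tendsto_atTop)
    rw [hSv, sub_eq_zero] at h2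
    exact h2.symm

variable {ι : Type*} {L : Filter ι} {K : H →L[ℝ] H} {P : ι → H →L[ℝ] H} {θ μ : ℝ}

theorem norm_projection_apply_le {Q : H →L[ℝ] H} (hs : ∀ u v, inner ℝ (Q u) v = inner ℝ u (Q v))
    (hi : ∀ u, Q (Q u) = Q u) (u : H) : ‖Q u‖ ≤ ‖u‖ := by
  have h : ‖Q u‖ * ‖Q u‖ ≤ ‖Q u‖ * ‖u‖ := by
    rw [← real_inner_self_eq_norm_mul_norm, hs, hi, real_inner_comm]
    exact real_inner_le_norm _ _
  rcases (norm_nonneg (Q u)).eq_or_lt with h0 | h0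
  · rw [← h0]; positivity
  · exact le_of_mul_le_mul_left h h0

/-- The image of the unit ball under `K` is totally bounded, so convergence need only be used at the
finitely many pairs from a net. The forms are bounded by `1 + |θ|` uniformly in `i`, because
projections are contractions. -/
theorem eventually_form_le (hK : IsCompactOperator K)
    (hPs : ∀ i u v, inner ℝ (P i u) v = inner ℝ u (P i v)) (hPi : ∀ i u, P i (P i u) = P i u)
    (hw : ∀ u v, Tendsto (fun i => inner ℝ (P i (K u)) (K v)) L (𝓝 (θ * inner ℝ (K u) (K v))))
    {δ : ℝ} (hδ : 0 < δ) :
    ∀ᶠ i in L, ∀ u v, ‖u‖ ≤ 1 → ‖v‖ ≤ 1 →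
      |inner ℝ (P i (K u)) (K v) - θ * inner ℝ (K u) (K v)| ≤ δ := by
  -- Replacing each argument by a net point costs at most `c * η = δ / 3`; the last third is the
  -- error on the net.
  set c := (1 + |θ|) * (‖K‖ + 1) with hc
  have hc0 : 0 < c := by positivity
  set η := δ / (3 * c) with hη
  have hη0 : 0 < η := by positivity
  have htb : TotallyBounded (K '' Metric.closedBall 0 1) :=
    ((hK.isCompact_closure_image_closedBall (M₁ := H) 1).totallyBounded).subset subset_closure
  obtain ⟨s, hs1, hs2, hs3⟩ := Metric.finite_approx_of_totallyBounded htb η hη0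
  have hev : ∀ᶠ i in L, ∀ x ∈ s, ∀ y ∈ s, |inner ℝ (P i x) y - θ * inner ℝ x y| ≤ δ / 3 := by
    rw [eventually_all_finite hs2]
    intro x hx
    rw [eventually_all_finite hs2]
    intro y hy
    obtain ⟨u, -, rfl⟩ := hs1 hx
    obtain ⟨v, -, rfl⟩ := hs1 hy
    have := (hw u v).sub_const (θ * inner ℝ (K u) (K v))
    rw [sub_self] at this
    have := this.abs
    rw [abs_zero] at this
    exact this.eventually_le_const (by positivity)
  filter_upwards [hev] with i hi u v hu hv
  have happ : ∀ u : H, ‖u‖ ≤ 1 → ∃ x ∈ s, ‖K u - x‖ ≤ η ∧ ‖K u‖ ≤ ‖K‖ + 1 := by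
    intro u hu
    have h1 := hs3 (Set.mem_image_of_mem K (show u ∈ Metric.closedBall 0 1 by simpa using hu))
    simp only [Set.mem_iUnion, Metric.mem_ball, exists_prop] at h1
    obtain ⟨x, hx, h⟩ := h1
    rw [dist_eq_norm] at h
    refine ⟨x, hx, h.le, ?_⟩
    have := K.le_opNorm u
    nlinarith [norm_nonneg K, norm_nonneg u]
  obtain ⟨x, hx, hxu, hKu⟩ := happ u hu
  obtain ⟨y, hy, hyv, hKv⟩ := happ v hv
  have hxn : ‖x‖ ≤ ‖K‖ + 1 := by
    obtain ⟨z, hz, rfl⟩ := hs1 hx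
    have := K.le_opNorm z
    have hz' : ‖z‖ ≤ 1 := by simpa using hz
    nlinarith [norm_nonneg K, norm_nonneg z]
  have hb : ∀ a b : H, |inner ℝ (P i a) b - θ * inner ℝ a b| ≤ (1 + |θ|) * (‖a‖ * ‖b‖) := by
    intro a b
    have h1 : |inner ℝ (P i a) b| ≤ ‖a‖ * ‖b‖ := (abs_real_inner_le_norm _ _).trans
      (by gcongr; exact norm_projection_apply_le (hPs i) (hPi i) a)
    have h2 : |θ * inner ℝ a b| ≤ |θ| * (‖a‖ * ‖b‖) := by
      rw [abs_mul]; gcongr; exact abs_real_inner_le_norm _ _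
    calc _ ≤ |inner ℝ (P i a) b| + |θ * inner ℝ a b| := abs_sub _ _
      _ ≤ _ := by linarith
  have e : inner ℝ (P i (K u)) (K v) - θ * inner ℝ (K u) (K v)
      = (inner ℝ (P i (K u - x)) (K v) - θ * inner ℝ (K u - x) (K v))
        + (inner ℝ (P i x) (K v - y) - θ * inner ℝ x (K v - y))
        + (inner ℝ (P i x) y - θ * inner ℝ x y) := by
    simp only [map_sub, inner_sub_left, inner_sub_right]; ring
  have b1 : |inner ℝ (P i (K u - x)) (K v) - θ * inner ℝ (K u - x) (K v)| ≤ c * η := by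
    refine (hb _ _).trans ?_
    calc (1 + |θ|) * (‖K u - x‖ * ‖K v‖) ≤ (1 + |θ|) * (η * (‖K‖ + 1)) := by gcongr
      _ = c * η := by rw [hc]; ring
  have b2 : |inner ℝ (P i x) (K v - y) - θ * inner ℝ x (K v - y)| ≤ c * η := by
    refine (hb _ _).trans ?_
    calc (1 + |θ|) * (‖x‖ * ‖K v - y‖) ≤ (1 + |θ|) * ((‖K‖ + 1) * η) := by gcongr
      _ = c * η := by rw [hc]; ring
  have hcη : c * η = δ / 3 := by rw [hη]; field_simp
  rw [e]
  calc _ ≤ _ + _ + _ := abs_add_three _ _ _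
    _ ≤ c * η + c * η + δ / 3 := by gcongr; exact hi x hx y hy
    _ = δ := by rw [hcη]; ring

theorem eventually_norm_sub_le (hK : IsCompactOperator K)
    (hKs : ∀ u v, inner ℝ (K u) v = inner ℝ u (K v))
    (hPs : ∀ i u v, inner ℝ (P i u) v = inner ℝ u (P i v)) (hPi : ∀ i u, P i (P i u) = P i u)
    (hw : ∀ u v, Tendsto (fun i => inner ℝ (P i (K u)) (K v)) L (𝓝 (θ * inner ℝ (K u) (K v))))
    {δ : ℝ} (hδ : 0 < δ) :
    ∀ᶠ i in L, ∀ u, ‖u‖ ≤ 1 → ‖K (P i (K u)) - θ • K (K u)‖ ≤ δ := by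
  filter_upwards [eventually_form_le hK hPs hPi hw hδ] with i hi u hu
  set D := K (P i (K u)) - θ • K (K u) with hD
  rcases eq_or_ne D 0 with h0 | h0
  · rw [h0, norm_zero]; exact hδ.le
  have hn : ‖D‖ ≠ 0 := norm_ne_zero_iff.2 h0
  have h1 := hi u (‖D‖⁻¹ • D) hu (by simp [norm_smul, hn])
  have h2 : inner ℝ (P i (K u)) (K (‖D‖⁻¹ • D)) - θ * inner ℝ (K u) (K (‖D‖⁻¹ • D)) = ‖D‖ := by
    rw [← hKs, ← hKs (K u), ← real_inner_smul_left _ _ θ, ← inner_sub_left, ← hD,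
      real_inner_smul_right, real_inner_self_eq_norm_mul_norm]
    field_simp
  rw [h2] at h1
  exact (le_abs_self _).trans h1

/-- Homogenization of the top eigenvalue: if the projections `P i` converge weakly to the scalar
`θ` on the range of `K`, the top eigenvalue of `P i ∘ K ∘ P i` converges to `θ` times that of `K`. -/
theorem eventually_exists_isTopEigenvalue (hK : IsCompactOperator K)
    (hKs : ∀ u v, inner ℝ (K u) v = inner ℝ u (K v))
    (hPs : ∀ i u v, inner ℝ (P i u) v = inner ℝ u (P i v)) (hPi : ∀ i u, P i (P i u) = P i u)
    (hw : ∀ u v, Tendsto (fun i => inner ℝ (P i (K u)) (K v)) L (𝓝 (θ * inner ℝ (K u) (K v))))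
    (hθ : 0 < θ) (hμ : 0 < μ) (htop : IsTopEigenvalue K μ) :
    (∀ᶠ i in L, ∃ ν, 0 < ν ∧ IsTopEigenvalue (P i ∘L K ∘L P i) ν) ∧
    ∀ ν : ι → ℝ, (∀ᶠ i in L, 0 < ν i ∧ IsTopEigenvalue (P i ∘L K ∘L P i) (ν i)) →
      Tendsto ν L (𝓝 (θ * μ)) := by
  obtain ⟨⟨φ, hφ0, hφ⟩, hμle⟩ := htop
  have hφn : 0 < ‖φ‖ := norm_pos_iff.2 hφ0
  -- Weak convergence is assumed only on the range of `K`, so `φ` is exhibited there.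
  have hφK : φ = K (μ⁻¹ • φ) := by rw [map_smul, hφ, inv_smul_smul₀ hμ.ne']
  have hnorm : Tendsto (fun i => ‖P i φ‖ ^ 2) L (𝓝 (θ * ‖φ‖ ^ 2)) := by
    have := hw (μ⁻¹ • φ) (μ⁻¹ • φ)
    rw [← hφK, real_inner_self_eq_norm_sq] at this
    refine this.congr fun i => ?_
    rw [← real_inner_self_eq_norm_sq, hPs i φ (P i φ), hPi, real_inner_comm]
  have hKP : Tendsto (fun i => K (P i φ) - θ • K φ) L (𝓝 0) := by
    rw [Metric.tendsto_nhds]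
    intro δ hδ
    have hc : 0 < 2 * ‖μ⁻¹ • φ‖ + 1 := by positivity
    filter_upwards [eventually_norm_sub_le hK hKs hPs hPi hw
      (δ := δ * ‖μ⁻¹ • φ‖⁻¹ / 2) (by have := smul_ne_zero (inv_ne_zero hμ.ne') hφ0; positivity)]
      with i hi
    have hψ : μ⁻¹ • φ ≠ 0 := smul_ne_zero (inv_ne_zero hμ.ne') hφ0
    have hψn : 0 < ‖μ⁻¹ • φ‖ := norm_pos_iff.2 hψ
    have h1 := hi (‖μ⁻¹ • φ‖⁻¹ • (μ⁻¹ • φ)) (by rw [norm_smul, norm_inv, norm_norm, inv_mul_cancel₀ hψn.ne'])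
    rw [map_smul K, ← hφK, map_smul, map_smul, map_smul, smul_comm θ, ← smul_sub, norm_smul,
      norm_inv, norm_norm] at h1
    rw [dist_zero_right]
    have h2 : ‖μ⁻¹ • φ‖⁻¹ * ‖K (P i φ) - θ • K φ‖ ≤ ‖μ⁻¹ • φ‖⁻¹ * (δ / 2) := by linarith
    have := le_of_mul_le_mul_left h2 (by positivity)
    linarith
  have hPin : Tendsto (fun i => inner ℝ (P i φ) φ) L (𝓝 (θ * ‖φ‖ ^ 2)) := by
    refine hnorm.congr fun i => ?_
    rw [← real_inner_self_eq_norm_sq, hPs i φ (P i φ), hPi, real_inner_comm]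
  have hform : Tendsto (fun i => inner ℝ (K (P i φ)) (P i φ)) L (𝓝 (θ * (μ * (θ * ‖φ‖ ^ 2)))) := by
    have h1 : Tendsto (fun i => inner ℝ (K (P i φ) - θ • K φ) (P i φ)) L (𝓝 0) := by
      have h2 : Tendsto (fun i => ‖K (P i φ) - θ • K φ‖ * ‖φ‖) L (𝓝 0) := by
        simpa using hKP.norm.mul_const ‖φ‖
      refine squeeze_zero_norm (fun i => ?_) h2
      refine (abs_real_inner_le_norm _ _).trans ?_
      gcongr
      exact norm_projection_apply_le (hPs i) (hPi i) φ
    have h3 := h1.add (((hPin.const_mul μ).const_mul θ))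
    rw [zero_add] at h3
    refine h3.congr fun i => ?_
    rw [inner_sub_left, real_inner_smul_left, hφ, real_inner_smul_left, real_inner_comm φ]
    ring
  have hformP : ∀ i v, inner ℝ ((P i ∘L K ∘L P i) v) v = inner ℝ (K (P i v)) (P i v) :=
    fun i v => by simp [hPs]
  constructor
  · filter_upwards [hform.eventually_const_lt (show 0 < θ * (μ * (θ * ‖φ‖ ^ 2)) by positivity)]
      with i hi
    refine exists_isTopEigenvalue _ ((hK.comp_clm (P i)).clm_comp (P i)) (fun u v => ?_)
      (v₀ := φ) (by rwa [hformP])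
    simp only [ContinuousLinearMap.comp_apply]
    rw [hPs, hKs, hPs]
  · intro ν hν
    rw [tendsto_order]
    constructor
    -- Lower bound: the test vector `P i φ` has Rayleigh quotient tending to `θ * μ`, since `K (P i
    -- φ)` is close to `θ * μ` times `φ`.
    · intro a ha
      have hq : Tendsto (fun i => inner ℝ (K (P i φ)) (P i φ) - a * ‖P i φ‖ ^ 2) L
          (𝓝 (θ * (μ * (θ * ‖φ‖ ^ 2)) - a * (θ * ‖φ‖ ^ 2))) := hform.sub (hnorm.const_mul a)
      have hp : 0 < θ * (μ * (θ * ‖φ‖ ^ 2)) - a * (θ * ‖φ‖ ^ 2) := by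
        have : 0 < (θ * μ - a) * (θ * ‖φ‖ ^ 2) := mul_pos (by linarith) (by positivity)
        nlinarith
      filter_upwards [hν, hq.eventually_const_lt hp] with i hi h
      by_contra hcon
      push Not at hcon
      have h1 := hi.2.2 (P i φ)
      rw [hformP, hPi] at h1
      nlinarith [sq_nonneg ‖P i φ‖]
    · intro b hb
      have hθμ : 0 < θ * μ := mul_pos hθ hμ
      -- Upper bound: a unit eigenvector `u` gives `w = K u` with `ν i • w = K (P i w)`, which is
      -- close to `θ • K w`. The tolerance is half of the lower bound `(b - θ * μ) * (θ * μ)` that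
      -- `ν i ≥ b` and `‖w‖ ≥ ν i` would give for `(ν i - θ * μ) * ‖w‖`.
      filter_upwards [hν, eventually_norm_sub_le hK hKs hPs hPi hw
        (δ := (b - θ * μ) / 2 * (θ * μ)) (mul_pos (by linarith) hθμ)] with i hi h
      by_contra hcon
      push Not at hcon
      obtain ⟨hν0, ⟨u', hu0, hu'⟩, -⟩ := hi
      have hu'n : ‖u'‖ ≠ 0 := norm_ne_zero_iff.2 hu0
      obtain ⟨u, hun, hu⟩ : ∃ u, ‖u‖ = 1 ∧ P i (K (P i u)) = ν i • u := by
        refine ⟨‖u'‖⁻¹ • u', by simp [norm_smul, hu'n], ?_⟩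
        simp only [ContinuousLinearMap.comp_apply] at hu'
        simp only [map_smul, hu']
        rw [smul_comm]
      -- Eigenvectors for a nonzero eigenvalue lie in the range of the projection.
      have hPu : P i u = u := by
        have h1 : u = (ν i)⁻¹ • P i (K (P i u)) := by rw [hu, inv_smul_smul₀ hν0.ne']
        rw [h1, map_smul, hPi]
      rw [hPu] at hu
      have h1 := h u hun.le
      rw [hu, map_smul] at h1
      set w := K u with hw'
      have hwn : ν i ≤ ‖w‖ := by
        have h2 := norm_projection_apply_le (hPs i) (hPi i) w
        rw [hu, norm_smul, hun, Real.norm_of_nonneg hν0.le] at h2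
        linarith
      have h3 : ν i * ‖w‖ ^ 2 - θ * inner ℝ (K w) w ≤ (b - θ * μ) / 2 * (θ * μ) * ‖w‖ := by
        have h4 : inner ℝ (ν i • w - θ • K w) w ≤ ‖ν i • w - θ • K w‖ * ‖w‖ :=
          real_inner_le_norm _ _
        rw [inner_sub_left, real_inner_smul_left, real_inner_smul_left,
          real_inner_self_eq_norm_sq] at h4
        nlinarith [norm_nonneg w]
      have h5 := mul_le_mul_of_nonneg_left (hμle w) hθ.le
      have hw0 : 0 < ‖w‖ := lt_of_lt_of_le hν0 hwn
      have h6 : (ν i - θ * μ) * ‖w‖ ≤ (b - θ * μ) / 2 * (θ * μ) := by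
        refine le_of_mul_le_mul_right ?_ hw0
        nlinarith
      have h7 : (b - θ * μ) * (θ * μ) ≤ (ν i - θ * μ) * ‖w‖ :=
        mul_le_mul (by linarith) (by linarith) hθμ.le (by linarith)
      nlinarith [mul_pos (sub_pos.2 hb) hθμ]

end Rayleigh

/-! ### Hilbert–Schmidt operators and indicator projections on `L²` -/

section HilbertSchmidt

variable {α : Type*} [MeasurableSpace α] {ν : Measure α}

/-- The Hilbert–Schmidt operator `u ↦ ⟪u, F ·⟫` of a square-integrable `H`-valued kernel. -/
theorem exists_isCompactOperator_inner {H : Type*} [NormedAddCommGroup H] [InnerProductSpace ℝ H]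
    (F : Lp H 2 ν) : ∃ T : H →L[ℝ] Lp ℝ 2 ν, IsCompactOperator T ∧
      ∀ u, T u =ᵐ[ν] fun x => inner ℝ u (F x) := by
  let B : H →L[ℝ] H →L[ℝ] ℝ := (innerₗ H).mkContinuous₂ 1 fun u v => by
    simpa using abs_real_inner_le_norm u v
  have hB : ∀ u v, B u v = inner ℝ u v := fun u v => rfl
  let Φ : Lp H 2 ν →L[ℝ] (H →L[ℝ] Lp ℝ 2 ν) := (B.compLpL₂ 2 ν).flip
  have hΦ : ∀ F u, Φ F u = (B u).compLp F := fun F u => rfl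
  refine ⟨Φ F, ?_, fun u => ?_⟩
  -- A constant on a set of finite measure gives an operator of rank at most one. Sums and limits
  -- stay compact, as `F ↦ Φ F` is continuous and compact operators form a closed set.
  · refine Lp.induction ENNReal.ofNat_ne_top (motive := fun F => IsCompactOperator (Φ F))
      (fun c s hs hμs => ?_) (fun f g _ _ _ hf hg => ?_) ?_ F
    · have h : Φ (Lp.simpleFunc.indicatorConst 2 hs hμs.ne c)
          = (ContinuousLinearMap.toSpanSingleton ℝ (indicatorConstLp 2 hs hμs.ne (1 : ℝ))).comp
            (B.flip c) := by
        ext1 u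
        rw [hΦ, Lp.simpleFunc.coe_indicatorConst]
        apply Lp.ext
        simp only [ContinuousLinearMap.comp_apply, ContinuousLinearMap.toSpanSingleton_apply,
          ContinuousLinearMap.flip_apply]
        filter_upwards [(B u).coeFn_compLp (indicatorConstLp 2 hs hμs.ne c),
          Lp.coeFn_smul (B u c) (indicatorConstLp 2 hs hμs.ne (1 : ℝ)),
          indicatorConstLp_coeFn (p := 2) (hs := hs) (hμs := hμs.ne) (c := c),
          indicatorConstLp_coeFn (p := 2) (hs := hs) (hμs := hμs.ne) (c := (1 : ℝ))]
          with x h1 h2 h3 h4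
        rw [h1, h2, Pi.smul_apply, h3, h4]
        by_cases hx : x ∈ s <;> simp [hx]
      rw [h]
      have hc : IsCompactOperator (B.flip c) :=
        isCompactOperator_of_locallyCompactSpace_dom (M₂ := ℝ) (B.flip c)
      exact hc.clm_comp (ContinuousLinearMap.toSpanSingleton ℝ _)
    · rw [map_add]
      exact hf.add hg
    · exact isClosed_setOfPred_isCompactOperator.preimage Φ.continuous
  · rw [hΦ]
    filter_upwards [(B u).coeFn_compLp F] with x hx
    rw [hx, hB]

/-- Multiplication by the indicator of a measurable set, as an operator on `L²`. -/
theorem exists_indicator_clm {E : Set α} (hE : MeasurableSet E) :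
    ∃ P : Lp ℝ 2 ν →L[ℝ] Lp ℝ 2 ν, ∀ u, P u =ᵐ[ν] E.indicator u := by
  have key : ∀ u : Lp ℝ 2 ν, ((Lp.memLp u).indicator hE).toLp _ =ᵐ[ν] E.indicator u :=
    fun u => MemLp.coeFn_toLp _
  refine ⟨LinearMap.mkContinuous
    { toFun := fun u => ((Lp.memLp u).indicator hE).toLp _
      map_add' := fun u v => ?_
      map_smul' := fun c u => ?_ } 1 fun u => ?_, fun u => key u⟩
  · apply Lp.ext
    filter_upwards [key (u + v), key u, key v, Lp.coeFn_add u v,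
      Lp.coeFn_add (((Lp.memLp u).indicator hE).toLp _) (((Lp.memLp v).indicator hE).toLp _)]
      with x h1 h2 h3 h4 h5
    rw [h1, h5, Pi.add_apply, h2, h3]
    by_cases hx : x ∈ E
    · simp only [Set.indicator_of_mem hx, h4, Pi.add_apply]
    · simp [hx]
  · apply Lp.ext
    filter_upwards [key (c • u), key u, Lp.coeFn_smul c u,
      Lp.coeFn_smul c (((Lp.memLp u).indicator hE).toLp _)] with x h1 h2 h3 h4
    simp only [RingHom.id_apply]
    rw [h1, h4, Pi.smul_apply, h2]
    by_cases hx : x ∈ E <;> simp [hx, h3]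
  · rw [one_mul]
    refine Lp.norm_le_norm_of_ae_le ?_
    filter_upwards [key u] with x hx
    simp only [LinearMap.coe_mk, AddHom.coe_mk]
    rw [hx]
    exact norm_indicator_le_norm_self _ _

theorem inner_indicator_clm {E : Set α} (hE : MeasurableSet E) {P : Lp ℝ 2 ν →L[ℝ] Lp ℝ 2 ν}
    (hP : ∀ u, P u =ᵐ[ν] E.indicator u) (u v : Lp ℝ 2 ν) :
    inner ℝ (P u) v = ∫ x in E, u x * v x ∂ν := by
  rw [L2.inner_def, ← integral_indicator hE]
  refine integral_congr_ae ?_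
  filter_upwards [hP u] with x hx
  rw [hx]
  by_cases hxE : x ∈ E <;> simp [hxE, mul_comm]

theorem indicator_clm_symm {E : Set α} (hE : MeasurableSet E) {P : Lp ℝ 2 ν →L[ℝ] Lp ℝ 2 ν}
    (hP : ∀ u, P u =ᵐ[ν] E.indicator u) (u v : Lp ℝ 2 ν) :
    inner ℝ (P u) v = inner ℝ u (P v) := by
  rw [real_inner_comm (P v), inner_indicator_clm hE hP, inner_indicator_clm hE hP]
  simp only [mul_comm]

theorem indicator_clm_idem {E : Set α} {P : Lp ℝ 2 ν →L[ℝ] Lp ℝ 2 ν}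
    (hP : ∀ u, P u =ᵐ[ν] E.indicator u) (u : Lp ℝ 2 ν) : P (P u) = P u := by
  apply Lp.ext
  filter_upwards [hP u, hP (P u)] with x h1 h2
  rw [h2]
  by_cases hx : x ∈ E
  · simp [hx]
  · rw [h1]; simp [hx]

end HilbertSchmidt

/-! ### The convolution operator cut off to a set, and its link with first eigenvalues -/

section NonlocalOperator

variable {N : ℕ} {J : EuclideanSpace ℝ (Fin N) → ℝ} {Ω : Set (EuclideanSpace ℝ (Fin N))}

theorem KernelH.abs_apply_le (hJ : KernelH J) (x : EuclideanSpace ℝ (Fin N)) : |J x| ≤ J 0 := by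
  rw [abs_of_nonneg (hJ.nonneg x)]
  exact hJ.decreasing 0 x (by simp)

theorem KernelH.sub_comm (hJ : KernelH J) (x y : EuclideanSpace ℝ (Fin N)) :
    J (x - y) = J (y - x) := hJ.radial _ _ (norm_sub_rev x y)

theorem KernelH.memLp_indicator (hJ : KernelH J) (hΩ : MeasurableSet Ω) (hfin : volume Ω ≠ ⊤)
    (x : EuclideanSpace ℝ (Fin N)) :
    MemLp (Ω.indicator fun y => J (x - y)) 2 volume := by
  have : IsFiniteMeasure (volume.restrict Ω) := ⟨by simpa using hfin.lt_top⟩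
  rw [memLp_indicator_iff_restrict hΩ]
  refine MemLp.of_bound ?_ (J 0) (Eventually.of_forall fun y => hJ.abs_apply_le _)
  exact (hJ.continuous.comp (continuous_const.sub continuous_id)).aestronglyMeasurable

/-- Dominated convergence on `Ω`, with `J` bounded by `J 0`. Continuity supplies the strong
measurability of the `L²`-valued kernel. -/
theorem KernelH.continuous_toLp (hJ : KernelH J) (hΩ : MeasurableSet Ω) (hfin : volume Ω ≠ ⊤) :
    Continuous fun x => (hJ.memLp_indicator hΩ hfin x).toLp := by
  have : IsFiniteMeasure (volume.restrict Ω) := ⟨by simpa using hfin.lt_top⟩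
  rw [continuous_iff_continuousAt]
  intro x₀
  rw [ContinuousAt, tendsto_iff_norm_sub_tendsto_zero]
  have hsq : ∀ x, ‖(hJ.memLp_indicator hΩ hfin x).toLp - (hJ.memLp_indicator hΩ hfin x₀).toLp‖ ^ 2
      = ∫ y in Ω, (J (x - y) - J (x₀ - y)) ^ 2 := by
    intro x
    rw [← real_inner_self_eq_norm_sq, L2.inner_def, ← integral_indicator hΩ]
    refine integral_congr_ae ?_
    filter_upwards [(hJ.memLp_indicator hΩ hfin x).coeFn_toLp,
      (hJ.memLp_indicator hΩ hfin x₀).coeFn_toLp, Lp.coeFn_sub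
      (hJ.memLp_indicator hΩ hfin x).toLp (hJ.memLp_indicator hΩ hfin x₀).toLp] with y h1 h2 h3
    rw [h3, Pi.sub_apply, h1, h2]
    by_cases hy : y ∈ Ω <;> simp [hy, sq]
  have hlim : Tendsto (fun x => ∫ y in Ω, (J (x - y) - J (x₀ - y)) ^ 2) (𝓝 x₀) (𝓝 0) := by
    have hc := hJ.continuous
    have h0 : (0 : ℝ) = ∫ y in Ω, (0 : ℝ) := by simp
    rw [h0]
    refine tendsto_integral_filter_of_dominated_convergence (fun _ => (2 * J 0) ^ 2)
      (Eventually.of_forall fun x => ?_) (Eventually.of_forall fun x => ?_)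
      (integrable_const _) (Eventually.of_forall fun y => ?_)
    · exact Continuous.aestronglyMeasurable (by fun_prop)
    · refine Eventually.of_forall fun y => ?_
      have h1 := abs_le.1 (hJ.abs_apply_le (x - y))
      have h2 := abs_le.1 (hJ.abs_apply_le (x₀ - y))
      rw [Real.norm_of_nonneg (sq_nonneg _)]
      exact sq_le_sq' (by linarith) (by linarith)
    · have h1 : Continuous fun x => (J (x - y) - J (x₀ - y)) ^ 2 := by fun_prop
      simpa using h1.tendsto x₀
  have := (hlim.congr fun x => (hsq x).symm).sqrt
  simpa using this

theorem KernelH.exists_nonlocal_clm (hJ : KernelH J) (hΩ : MeasurableSet Ω) (hfin : volume Ω ≠ ⊤) :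
    ∃ K : Lp ℝ 2 (volume : Measure (EuclideanSpace ℝ (Fin N))) →L[ℝ] Lp ℝ 2 volume,
      IsCompactOperator K ∧
      ∀ u, K u =ᵐ[volume] Ω.indicator fun x => ∫ y in Ω, J (x - y) * u y := by
  have : IsFiniteMeasure (volume.restrict Ω) := ⟨by simpa using hfin.lt_top⟩
  have hk := hJ.continuous_toLp hΩ hfin
  have hbd : ∀ x, ‖(hJ.memLp_indicator hΩ hfin x).toLp‖ ≤ √((J 0) ^ 2 * volume.real Ω) := by
    intro x
    refine Real.le_sqrt_of_sq_le ?_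
    rw [← real_inner_self_eq_norm_sq, L2.inner_def]
    have h1 : ∫ y, inner ℝ (MemLp.toLp _ (hJ.memLp_indicator hΩ hfin x) y)
        (MemLp.toLp _ (hJ.memLp_indicator hΩ hfin x) y) = ∫ y in Ω, J (x - y) ^ 2 := by
      rw [← integral_indicator hΩ]
      refine integral_congr_ae ?_
      filter_upwards [(hJ.memLp_indicator hΩ hfin x).coeFn_toLp] with y h1
      rw [h1]
      by_cases hy : y ∈ Ω <;> simp [hy, sq]
    rw [h1]
    refine (Real.le_norm_self _).trans ?_
    refine norm_setIntegral_le_of_norm_le_const hfin.lt_top (fun y _ => ?_)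
    rw [Real.norm_of_nonneg (sq_nonneg _), ← sq_abs]
    gcongr
    exact hJ.abs_apply_le _
  have hF : MemLp (Ω.indicator fun x => MemLp.toLp _ (hJ.memLp_indicator hΩ hfin x)) 2 volume := by
    rw [memLp_indicator_iff_restrict hΩ]
    exact MemLp.of_bound hk.aestronglyMeasurable _ (Eventually.of_forall hbd)
  obtain ⟨K, hK, hKu⟩ := exists_isCompactOperator_inner hF.toLp
  refine ⟨K, hK, fun u => ?_⟩
  filter_upwards [hKu u, hF.coeFn_toLp] with x h1 h2
  rw [h1, h2]
  by_cases hx : x ∈ Ω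
  · simp only [Set.indicator_of_mem hx]
    rw [L2.inner_def, ← integral_indicator hΩ]
    refine integral_congr_ae ?_
    filter_upwards [(hJ.memLp_indicator hΩ hfin x).coeFn_toLp] with y h3
    rw [h3]
    by_cases hy : y ∈ Ω <;> simp [hy]
  · simp [hx]

theorem inner_nonlocal_clm (hΩ : MeasurableSet Ω)
    {K : Lp ℝ 2 (volume : Measure (EuclideanSpace ℝ (Fin N))) →L[ℝ] Lp ℝ 2 volume}
    (hK : ∀ u, K u =ᵐ[volume] Ω.indicator fun x => ∫ y in Ω, J (x - y) * u y)
    (u v : Lp ℝ 2 (volume : Measure (EuclideanSpace ℝ (Fin N)))) :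
    inner ℝ (K u) v = ∫ x in Ω, (∫ y in Ω, J (x - y) * u y) * v x := by
  rw [L2.inner_def, ← integral_indicator hΩ]
  refine integral_congr_ae ?_
  filter_upwards [hK u] with x hx
  rw [hx]
  by_cases hxE : x ∈ Ω <;> simp [hxE, mul_comm]

theorem integrableOn_of_L2 (hfin : volume Ω ≠ ⊤)
    (u : Lp ℝ 2 (volume : Measure (EuclideanSpace ℝ (Fin N)))) : IntegrableOn u Ω volume := by
  have : IsFiniteMeasure (volume.restrict Ω) := ⟨by simpa using hfin.lt_top⟩
  exact ((Lp.memLp u).restrict Ω).integrable (by norm_num)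

/-- Fubini, since `J` is even and bounded. -/
theorem KernelH.nonlocal_clm_symm (hJ : KernelH J) (hΩ : MeasurableSet Ω) (hfin : volume Ω ≠ ⊤)
    {K : Lp ℝ 2 (volume : Measure (EuclideanSpace ℝ (Fin N))) →L[ℝ] Lp ℝ 2 volume}
    (hK : ∀ u, K u =ᵐ[volume] Ω.indicator fun x => ∫ y in Ω, J (x - y) * u y)
    (u v : Lp ℝ 2 (volume : Measure (EuclideanSpace ℝ (Fin N)))) :
    inner ℝ (K u) v = inner ℝ u (K v) := by
  rw [real_inner_comm (K v) u, inner_nonlocal_clm hΩ hK, inner_nonlocal_clm hΩ hK]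
  simp only [← integral_mul_const]
  rw [integral_integral_swap]
  · simp only [hJ.sub_comm, mul_right_comm]
  · have h1 := (integrableOn_of_L2 hfin v).mul_prod (integrableOn_of_L2 hfin u)
    have h2 := h1.bdd_mul (f := fun z : EuclideanSpace ℝ (Fin N) × EuclideanSpace ℝ (Fin N) =>
      J (z.1 - z.2)) (c := J 0) (hJ.continuous.comp continuous_sub).aestronglyMeasurable
      (Eventually.of_forall fun z => hJ.abs_apply_le _)
    refine h2.congr (Eventually.of_forall fun z => ?_)
    simp only [Function.uncurry]
    ring

/-- The indicator of `Ω` works: `J (x - ·)` is positive near `x`, so its integral over the open set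
`Ω` is positive for each `x ∈ Ω`. -/
theorem KernelH.exists_nonlocal_form_pos (hJ : KernelH J) (hΩo : IsOpen Ω) (hΩne : Ω.Nonempty)
    (hfin : volume Ω ≠ ⊤)
    {K : Lp ℝ 2 (volume : Measure (EuclideanSpace ℝ (Fin N))) →L[ℝ] Lp ℝ 2 volume}
    (hK : ∀ u, K u =ᵐ[volume] Ω.indicator fun x => ∫ y in Ω, J (x - y) * u y) :
    ∃ v, 0 < inner ℝ (K v) v := by
  have : IsFiniteMeasure (volume.restrict Ω) := ⟨by simpa using hfin.lt_top⟩
  have hΩ := hΩo.measurableSet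
  set v := indicatorConstLp (E := ℝ) 2 hΩ hfin 1 with hv
  have hv1 : ∀ᵐ y ∂volume.restrict Ω, v y = 1 := by
    rw [ae_restrict_iff' hΩ]
    exact indicatorConstLp_coeFn_mem
  have hinn : ∀ x, ∫ y in Ω, J (x - y) * v y = ∫ y in Ω, J (x - y) := fun x => by
    refine integral_congr_ae ?_
    filter_upwards [hv1] with y hy
    rw [hy, mul_one]
  have hint : IntegrableOn (fun x => ∫ y in Ω, J (x - y)) Ω volume := by
    refine (integrableOn_of_L2 hfin (K v)).congr ?_
    rw [EventuallyEq, ae_restrict_iff' hΩ]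
    filter_upwards [hK v] with x hx hxΩ
    rw [hx, Set.indicator_of_mem hxΩ, hinn]
  refine ⟨v, ?_⟩
  rw [inner_nonlocal_clm hΩ hK]
  have h1 : ∫ x in Ω, (∫ y in Ω, J (x - y) * v y) * v x = ∫ x in Ω, ∫ y in Ω, J (x - y) := by
    refine integral_congr_ae ?_
    filter_upwards [hv1] with x hx
    rw [hx, mul_one, hinn]
  have hpos : ∀ x ∈ Ω, 0 < ∫ y in Ω, J (x - y) := by
    intro x hx
    have hc : Continuous fun y => J (x - y) := hJ.continuous.comp (continuous_const.sub continuous_id)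
    rw [setIntegral_pos_iff_support_of_nonneg_ae
      (Eventually.of_forall fun y => hJ.nonneg _)]
    · refine (IsOpen.inter hc.isOpen_support hΩo).measure_pos volume ⟨x, ?_, hx⟩
      simpa using hJ.pos_zero.ne'
    · exact Integrable.of_bound hc.aestronglyMeasurable (J 0)
        (Eventually.of_forall fun y => hJ.abs_apply_le _)
  rw [h1, setIntegral_pos_iff_support_of_nonneg_ae
    (Eventually.of_forall fun x => integral_nonneg fun y => hJ.nonneg _) hint]
  refine lt_of_lt_of_le (hΩo.measure_pos volume hΩne) (measure_mono fun x hx => ?_)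
  exact ⟨(hpos x hx).ne', hx⟩

variable {E : Set (EuclideanSpace ℝ (Fin N))}

/-- Since `μ ≠ 0`, the eigenvector of `T` vanishes off `E`. Conversely, an eigenfunction for `l` is
an eigenvector of `T` for `1 - l`, and the form bound gives `1 - l ≤ μ`. -/
theorem isFirstEigenvalueB_of_isTopEigenvalue
    {T : Lp ℝ 2 (volume : Measure (EuclideanSpace ℝ (Fin N))) →L[ℝ] Lp ℝ 2 volume}
    (hT : ∀ u, T u =ᵐ[volume] E.indicator fun x => ∫ y in E, J (x - y) * u y) {μ : ℝ}
    (hμ : 0 < μ) (htop : IsTopEigenvalue T μ) : IsFirstEigenvalueB J E (1 - μ) := by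
  obtain ⟨⟨u, hu0, hu⟩, hle⟩ := htop
  constructor
  · have hae : ∀ᵐ x, μ * u x = E.indicator (fun x => ∫ y in E, J (x - y) * u y) x := by
      filter_upwards [hT u, Lp.coeFn_smul μ u] with x h1 h2
      rw [← h1, hu, h2, Pi.smul_apply, smul_eq_mul]
    refine ⟨u, ?_, hu0, ?_⟩
    · change ∀ᵐ x, x ∉ E → u x = 0
      filter_upwards [hae] with x hx hxE
      rw [Set.indicator_of_notMem hxE] at hx
      exact (mul_eq_zero.1 hx).resolve_left hμ.ne'
    · filter_upwards [hae] with x hx hxE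
      rw [Set.indicator_of_mem hxE] at hx
      rw [nonlocalB, ← hx]
      ring
  · rintro l ⟨w, hwE, hw0, hw⟩
    have hwE' : ∀ᵐ x, x ∉ E → w x = 0 := hwE
    have hTw : T w = (1 - l) • w := by
      apply Lp.ext
      filter_upwards [hT w, Lp.coeFn_smul (1 - l) w, hwE', hw] with x h1 h2 h3 h4
      rw [h1, h2, Pi.smul_apply, smul_eq_mul]
      by_cases hx : x ∈ E
      · have := h4 hx
        rw [nonlocalB] at this
        rw [Set.indicator_of_mem hx]
        linarith
      · rw [Set.indicator_of_notMem hx, h3 hx, mul_zero]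
    have h1 := hle w
    rw [hTw, real_inner_smul_left, real_inner_self_eq_norm_sq] at h1
    have hn : 0 < ‖w‖ ^ 2 := by have := norm_pos_iff.2 hw0; positivity
    linarith [le_of_mul_le_mul_right h1 hn]

theorem isFirstEigenvalueB_congr_ae {E' : Set (EuclideanSpace ℝ (Fin N))}
    (h : E =ᵐ[volume] E') {l : ℝ} : IsFirstEigenvalueB J E l ↔ IsFirstEigenvalueB J E' l := by
  have hmem : ∀ᵐ x, x ∈ E ↔ x ∈ E' := by
    filter_upwards [h] with x hx using iff_of_eq hx
  have hB : ∀ u, nonlocalB J E u = nonlocalB J E' u := fun u => by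
    funext x
    rw [nonlocalB, nonlocalB, setIntegral_congr_set h]
  have hW : W E = W E' := by
    ext u
    change (∀ᵐ x, x ∉ E → u x = 0) ↔ ∀ᵐ x, x ∉ E' → u x = 0
    exact eventually_congr (hmem.mono fun x hx => by rw [hx])
  have key : ∀ l, IsEigenvalueB J E l ↔ IsEigenvalueB J E' l := fun l => by
    unfold IsEigenvalueB
    rw [hW]
    refine exists_congr fun u => and_congr_right fun _ => and_congr_right fun _ => ?_
    exact eventually_congr (hmem.mono fun x hx => by rw [hx, hB])
  simp only [IsFirstEigenvalueB, key]

theorem compression_nonlocal_clm (hΩ : MeasurableSet Ω) (hE : MeasurableSet E) (hEΩ : E ⊆ Ω)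
    {K P : Lp ℝ 2 (volume : Measure (EuclideanSpace ℝ (Fin N))) →L[ℝ] Lp ℝ 2 volume}
    (hK : ∀ u, K u =ᵐ[volume] Ω.indicator fun x => ∫ y in Ω, J (x - y) * u y)
    (hP : ∀ u, P u =ᵐ[volume] E.indicator u)
    (u : Lp ℝ 2 (volume : Measure (EuclideanSpace ℝ (Fin N)))) :
    (P ∘L K ∘L P) u =ᵐ[volume] E.indicator fun x => ∫ y in E, J (x - y) * u y := by
  simp only [ContinuousLinearMap.comp_apply]
  filter_upwards [hP (K (P u)), hK (P u)] with x h1 h2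
  rw [h1]
  by_cases hx : x ∈ E
  · rw [Set.indicator_of_mem hx, Set.indicator_of_mem hx, h2, Set.indicator_of_mem (hEΩ hx),
      ← integral_indicator hΩ, ← integral_indicator hE]
    refine integral_congr_ae ?_
    filter_upwards [hP u] with y hy
    by_cases hyE : y ∈ E
    · simp [hyE, hEΩ hyE, hy]
    · by_cases hyΩ : y ∈ Ω <;> simp [hyE, hyΩ, hy]
  · simp [hx]

end NonlocalOperator

/-! ### Weak limits of dilated periodic sets -/

section PeriodicWeakLimit

variable {N : ℕ}

theorem tendsto_integral_norm_translate_sub {f : EuclideanSpace ℝ (Fin N) → ℝ}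
    (hf : Integrable f volume) :
    Tendsto (fun s => ∫ x, ‖f (x + s) - f x‖) (𝓝 0) (𝓝 0) := by
  -- Currying makes `s ↦ (· + s)` continuous for the compact-open topology, as composition in `L¹`
  -- requires.
  let g : C(EuclideanSpace ℝ (Fin N), C(EuclideanSpace ℝ (Fin N), EuclideanSpace ℝ (Fin N))) :=
    (ContinuousMap.mk (fun p : EuclideanSpace ℝ (Fin N) × EuclideanSpace ℝ (Fin N) => p.2 + p.1)
      (by fun_prop)).curry
  have hmp : ∀ s, MeasurePreserving (g s) volume volume :=
    fun s => measurePreserving_add_right volume s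
  have h := (tendsto_const_nhds (x := hf.toL1 f)).compMeasurePreservingLp
    (g.continuous.tendsto 0) hmp (hmp 0) ENNReal.one_ne_top
  rw [tendsto_iff_norm_sub_tendsto_zero] at h
  refine h.congr fun s => ?_
  rw [L1.norm_eq_integral_norm]
  refine integral_congr_ae ?_
  filter_upwards [Lp.coeFn_sub (Lp.compMeasurePreserving (g s) (hmp s) (hf.toL1 f))
      (Lp.compMeasurePreserving (g 0) (hmp 0) (hf.toL1 f)),
    Lp.coeFn_compMeasurePreserving (hf.toL1 f) (hmp s),
    Lp.coeFn_compMeasurePreserving (hf.toL1 f) (hmp 0),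
    (hmp s).quasiMeasurePreserving.ae hf.coeFn_toL1,
    (hmp 0).quasiMeasurePreserving.ae hf.coeFn_toL1] with x h1 h2 h3 h4 h5
  rw [h1, Pi.sub_apply, h2, h3, Function.comp_apply, Function.comp_apply, h4, h5]
  simp [g]

variable {b : Module.Basis (Fin N) ℝ (EuclideanSpace ℝ (Fin N))}
  {S : Set (EuclideanSpace ℝ (Fin N))}

-- Both `D` and `s + D` are fundamental domains, and an invariant set has the same measure in each.
open scoped Pointwise in
theorem measure_translate_inter_fundamentalDomain (hS : MeasurableSet S)
    (hper : ∀ g ∈ Submodule.span ℤ (Set.range b), ∀ x, g + x ∈ S ↔ x ∈ S)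
    (s : EuclideanSpace ℝ (Fin N)) :
    volume ((fun t => s + t) ⁻¹' S ∩ ZSpan.fundamentalDomain b)
      = volume (S ∩ ZSpan.fundamentalDomain b) := by
  have hD := ZSpan.isAddFundamentalDomain' b (volume : Measure (EuclideanSpace ℝ (Fin N)))
  have : Countable (Submodule.span ℤ (Set.range b)).toAddSubgroup :=
    inferInstanceAs (Countable (Submodule.span ℤ (Set.range b)))
  have h1 := hD.measure_set_eq (hD.vadd_of_comm s) hS (fun g => by
    ext x
    exact hper g g.2 x)
  rw [h1, ← measure_preimage_add volume s (S ∩ (s +ᵥ ZSpan.fundamentalDomain b))]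
  congr 1
  ext t
  simp only [Set.mem_inter_iff, Set.mem_preimage]
  rw [← vadd_eq_add s t, Set.vadd_mem_vadd_set_iff]

/-- Dilations of a lattice-periodic set converge weakly to their density in a period cell. -/
theorem tendsto_setIntegral_periodic (hS : MeasurableSet S)
    (hper : ∀ g ∈ Submodule.span ℤ (Set.range b), ∀ x, g + x ∈ S ↔ x ∈ S)
    {f : EuclideanSpace ℝ (Fin N) → ℝ} (hf : Integrable f volume) :
    Tendsto (fun ε : ℝ => ∫ x in {x | ε⁻¹ • x ∈ S}, f x) (𝓝[>] 0)
      (𝓝 (volume.real (S ∩ ZSpan.fundamentalDomain b) / volume.real (ZSpan.fundamentalDomain b)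
        * ∫ x, f x)) := by
  set D := ZSpan.fundamentalDomain b with hD
  have hDm : MeasurableSet D := ZSpan.fundamentalDomain_measurableSet b
  have hDb : Bornology.IsBounded D := ZSpan.fundamentalDomain_isBounded b
  have hDfin : volume D < ⊤ := hDb.measure_lt_top
  have hD0 : 0 < volume.real D :=
    ENNReal.toReal_pos (ZSpan.measure_fundamentalDomain_ne_zero b) hDfin.ne
  have : IsFiniteMeasure (volume.restrict D) := ⟨by simpa using hDfin⟩
  let g : EuclideanSpace ℝ (Fin N) → ℝ := S.indicator 1
  have hg : Measurable g := measurable_const.indicator hS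
  have hg1 : ∀ x, ‖g x‖ ≤ 1 := fun x => by
    by_cases hx : x ∈ S <;> simp [g, hx]
  have hprod : ∀ c : ℝ, Integrable (Function.uncurry fun t x => g (c • x + t) * f x)
      ((volume.restrict D).prod volume) := fun c =>
    (hf.comp_snd (volume.restrict D)).bdd_mul (c := 1)
      (f := fun z : EuclideanSpace ℝ (Fin N) × EuclideanSpace ℝ (Fin N) => g (c • z.2 + z.1))
      (hg.comp (by fun_prop)).aestronglyMeasurable (Eventually.of_forall fun z => hg1 _)
  have hcell : ∀ s, ∫ t in D, g (s + t) = volume.real (S ∩ D) := fun s => by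
    have h1 : (fun t => g (s + t)) = ((fun t => s + t) ⁻¹' S).indicator 1 := by
      funext t; simp only [g, Set.indicator, Set.mem_preimage]; rfl
    rw [h1, integral_indicator_one (hS.preimage (measurable_const_add s)), measureReal_def,
      Measure.restrict_apply (hS.preimage (measurable_const_add s)),
      measure_translate_inter_fundamentalDomain hS hper, measureReal_def]
  -- Averaging over the shift `t ∈ D` gives exactly the limiting value at every scale `c`.
  have hJ : ∀ c : ℝ, ∫ t in D, ∫ x, g (c • x + t) * f x = volume.real (S ∩ D) * ∫ x, f x := by
    intro c
    rw [integral_integral_swap (hprod c)]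
    simp only [integral_mul_const, hcell, integral_const_mul]
  have hI : ∀ ε : ℝ, ∫ x in {x | ε⁻¹ • x ∈ S}, f x = ∫ x, g (ε⁻¹ • x) * f x := fun ε => by
    rw [← integral_indicator (show MeasurableSet {x | ε⁻¹ • x ∈ S} from
      hS.preimage (measurable_const_smul ε⁻¹))]
    congr 1
    funext x
    by_cases hx : ε⁻¹ • x ∈ S <;> simp [g, hx]
  have hgf : ∀ (c : ℝ) (t : EuclideanSpace ℝ (Fin N)) {h : EuclideanSpace ℝ (Fin N) → ℝ},
      Integrable h volume → Integrable (fun x => g (c • x + t) * h x) volume := fun c t h hh =>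
    hh.bdd_mul (hg.comp (by fun_prop)).aestronglyMeasurable (Eventually.of_forall fun z => hg1 _)
  simp only [hI]
  rw [Metric.tendsto_nhds]
  intro δ hδ
  obtain ⟨r, hr, hrδ⟩ := Metric.eventually_nhds_iff.1
    ((tendsto_integral_norm_translate_sub hf).eventually_lt_const (half_pos hδ))
  obtain ⟨M, hM0, hM⟩ := hDb.exists_pos_norm_le
  filter_upwards [Ioo_mem_nhdsGT (show 0 < r / M by positivity)] with ε hε
  have hε0 : ε ≠ 0 := hε.1.ne'
  set I := ∫ x, g (ε⁻¹ • x) * f x with hIdef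
  -- The shift by `t` is harmless: translating `x` by `ε • t` moves it onto `f`, where it costs a
  -- small `L¹` error because `‖ε • t‖ < r`.
  have hdiff : ∀ t ∈ D, ‖I - ∫ x, g (ε⁻¹ • x + t) * f x‖ ≤ δ / 2 := by
    intro t ht
    have h1 : I = ∫ x, g (ε⁻¹ • x + t) * f (x + ε • t) := by
      rw [hIdef, ← integral_add_right_eq_self (fun x => g (ε⁻¹ • x) * f x) (ε • t)]
      simp only [smul_add, inv_smul_smul₀ hε0]
    have hft : Integrable (fun x => f (x + ε • t)) volume := hf.comp_add_right _
    rw [h1, ← integral_sub (hgf _ _ hft) (hgf _ _ hf)]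
    have hs : ‖ε • t‖ < r := by
      rw [norm_smul, Real.norm_of_nonneg hε.1.le]
      calc ε * ‖t‖ ≤ ε * M := mul_le_mul_of_nonneg_left (hM t ht) hε.1.le
        _ < r := (lt_div_iff₀ hM0).1 hε.2
    refine le_trans ?_ (hrδ (y := ε • t) (by simpa using hs)).le
    refine norm_integral_le_of_norm_le (hft.sub hf).norm (Eventually.of_forall fun x => ?_)
    rw [← mul_sub, norm_mul]
    exact mul_le_of_le_one_left (norm_nonneg _) (hg1 _)
  have hint : IntegrableOn (fun t => ∫ x, g (ε⁻¹ • x + t) * f x) D volume :=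
    (hprod ε⁻¹).integral_prod_left
  have hkey : ‖volume.real D * I - volume.real (S ∩ D) * ∫ x, f x‖ ≤ δ / 2 * volume.real D := by
    have h1 := norm_setIntegral_le_of_norm_le_const hDfin hdiff
    rw [integral_sub (integrable_const _) hint, hJ, setIntegral_const, smul_eq_mul] at h1
    exact h1
  have h2 : I - volume.real (S ∩ D) / volume.real D * ∫ x, f x
      = (volume.real D)⁻¹ * (volume.real D * I - volume.real (S ∩ D) * ∫ x, f x) := by
    field_simp
  rw [dist_eq_norm, h2, norm_mul, norm_inv, Real.norm_of_nonneg hD0.le]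
  calc _ ≤ (volume.real D)⁻¹ * (δ / 2 * volume.real D) := by gcongr
    _ = δ / 2 := by field_simp
    _ < δ := half_lt_self hδ

end PeriodicWeakLimit

/-! ### The periodic holes and their density -/

section Holes

variable {N : ℕ} {l : Fin N → ℝ} {A : Set (EuclideanSpace ℝ (Fin N))}

/-- The lattice vector `k l = (k₁ l₁, …, k_N l_N)`. -/
noncomputable def latticeVec (l : Fin N → ℝ) (k : Fin N → ℤ) : EuclideanSpace ℝ (Fin N) :=
  WithLp.toLp 2 fun i => (k i : ℝ) * l i

/-- The periodic extension of `A` to the whole space. -/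
def periodicExt (l : Fin N → ℝ) (A : Set (EuclideanSpace ℝ (Fin N))) :
    Set (EuclideanSpace ℝ (Fin N)) :=
  ⋃ k : Fin N → ℤ, (fun x => x - latticeVec l k) ⁻¹' A

theorem mem_periodicExt {x : EuclideanSpace ℝ (Fin N)} :
    x ∈ periodicExt l A ↔ ∃ k, x - latticeVec l k ∈ A := by
  simp [periodicExt]

theorem mem_holes_iff {ε : ℝ} (hε : ε ≠ 0) {x : EuclideanSpace ℝ (Fin N)} :
    x ∈ holes l A ε ↔ ε⁻¹ • x ∈ periodicExt l A := by
  rw [mem_periodicExt]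
  simp only [holes, Set.mem_iUnion, Set.mem_image]
  refine exists_congr fun k => ⟨?_, fun h => ⟨_, h, ?_⟩⟩
  · rintro ⟨a, ha, rfl⟩
    rw [inv_smul_smul₀ hε, latticeVec, add_sub_cancel_left]
    exact ha
  · rw [latticeVec, add_sub_cancel, smul_inv_smul₀ hε]

theorem measurableSet_periodicExt (hA : MeasurableSet A) : MeasurableSet (periodicExt l A) :=
  MeasurableSet.iUnion fun _ => hA.preimage (measurable_id.sub_const _)

theorem periodicExt_congr_ae {A' : Set (EuclideanSpace ℝ (Fin N))} (h : A' =ᵐ[volume] A) :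
    periodicExt l A' =ᵐ[volume] periodicExt l A :=
  Filter.EventuallyEq.countable_iUnion fun k =>
    (measurePreserving_sub_right volume (latticeVec l k)).quasiMeasurePreserving.preimage_ae_eq h

theorem latticeVec_add (k k' : Fin N → ℤ) :
    latticeVec l (k + k') = latticeVec l k + latticeVec l k' := by
  ext i
  simp [latticeVec, add_mul]

/-- The basis `(l₁ e₁, …, l_N e_N)`. -/
noncomputable def cellBasis (hl : ∀ i, 0 < l i) :
    Module.Basis (Fin N) ℝ (EuclideanSpace ℝ (Fin N)) :=
  (EuclideanSpace.basisFun (Fin N) ℝ).toBasis.isUnitSMul (w := l) fun i => (hl i).ne'.isUnit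

theorem cellBasis_repr (hl : ∀ i, 0 < l i) (x : EuclideanSpace ℝ (Fin N)) (i : Fin N) :
    (cellBasis hl).repr x i = (l i)⁻¹ * x i := by
  rw [cellBasis, Module.Basis.repr_isUnitSMul]
  simp [Units.smul_def]

theorem exists_latticeVec_of_mem_span (hl : ∀ i, 0 < l i) {g : EuclideanSpace ℝ (Fin N)}
    (hg : g ∈ Submodule.span ℤ (Set.range (cellBasis hl))) : ∃ k, g = latticeVec l k := by
  obtain ⟨k, rfl⟩ := (Submodule.mem_span_range_iff_exists_fun ℤ).1 hg
  refine ⟨k, ?_⟩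
  apply (cellBasis hl).repr.injective
  ext i
  rw [cellBasis_repr hl (latticeVec l k)]
  have := (hl i).ne'
  simp only [map_sum, map_zsmul, Module.Basis.repr_self]
  simp [latticeVec, Finsupp.single_apply, Finset.sum_apply']
  field_simp

theorem periodicExt_periodic (hl : ∀ i, 0 < l i) (g : EuclideanSpace ℝ (Fin N))
    (hg : g ∈ Submodule.span ℤ (Set.range (cellBasis hl))) (x : EuclideanSpace ℝ (Fin N)) :
    g + x ∈ periodicExt l A ↔ x ∈ periodicExt l A := by
  obtain ⟨k, rfl⟩ := exists_latticeVec_of_mem_span hl hg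
  rw [mem_periodicExt, mem_periodicExt, ← (Equiv.addLeft k).exists_congr_right]
  refine exists_congr fun k' => ?_
  rw [Equiv.coe_addLeft, latticeVec_add, add_sub_add_left_eq_sub]

theorem mem_closure_cellQ {x : EuclideanSpace ℝ (Fin N)} (hx : x ∈ closure (cellQ l)) (i : Fin N) :
    0 ≤ x i ∧ x i ≤ l i := by
  have hc : IsClosed {x : EuclideanSpace ℝ (Fin N) | 0 ≤ x i ∧ x i ≤ l i} :=
    (isClosed_Icc (a := (0 : ℝ)) (b := l i)).preimage
      (show Continuous fun x : EuclideanSpace ℝ (Fin N) => x i by fun_prop)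
  have hsub : cellQ l ⊆ {x | 0 ≤ x i ∧ x i ≤ l i} := fun y hy => ⟨(hy i).1.le, (hy i).2.le⟩
  exact closure_minimal hsub hc hx

theorem periodicExt_inter_cellQ (hAQ : A ⊆ closure (cellQ l)) :
    periodicExt l A ∩ cellQ l = A ∩ cellQ l := by
  ext x
  refine and_congr_left fun hx => ?_
  rw [mem_periodicExt]
  constructor
  · rintro ⟨k, hk⟩
    -- With `x` in the open cell and its translate in the closed one, every `k i` lies strictly
    -- between `-1` and `1`.
    have hk0 : k = 0 := by
      funext i
      have h1 := mem_closure_cellQ (hAQ hk) i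
      have h2 := hx i
      have hl : 0 < l i := h2.1.trans h2.2
      have e : (x - latticeVec l k) i = x i - k i * l i := rfl
      rw [e] at h1
      have h3 : (k i : ℝ) < 1 := by
        by_contra hcon
        nlinarith
      have h4 : (-1 : ℝ) < k i := by
        by_contra hcon
        nlinarith
      have h5 : k i < 1 := by exact_mod_cast h3
      have h6 : -1 < k i := by exact_mod_cast h4
      simp only [Pi.zero_apply]
      omega
    have e : x - latticeVec l k = x := by
      ext i
      simp [latticeVec, hk0]
    rwa [e] at hk
  · intro h
    refine ⟨0, ?_⟩
    have e : x - latticeVec l 0 = x := by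
      ext i
      simp [latticeVec]
    rwa [e]

theorem cellQ_ae_eq_Icc :
    cellQ l =ᵐ[volume] {x : EuclideanSpace ℝ (Fin N) | ∀ i, 0 ≤ x i ∧ x i ≤ l i} := by
  have h := (PiLp.volume_preserving_ofLp (Fin N)).quasiMeasurePreserving.preimage_ae_eq
    (Measure.univ_pi_Ioo_ae_eq_Icc (μ := fun _ : Fin N => (volume : Measure ℝ))
      (f := fun _ => 0) (g := l))
  have e1 : cellQ l = WithLp.ofLp ⁻¹' (Set.univ.pi fun i => Set.Ioo 0 (l i)) := by
    ext x; simp [cellQ]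
  have e2 : {x : EuclideanSpace ℝ (Fin N) | ∀ i, 0 ≤ x i ∧ x i ≤ l i}
      = WithLp.ofLp ⁻¹' Set.Icc (fun _ => 0) l := by
    ext x; simp [Pi.le_def, forall_and]
  rw [e1, e2]
  exact h

/-- The boundary of the cell is null; this serves both the closed cell and the half-open fundamental
domain. -/
theorem ae_eq_cellQ_of_subset {B : Set (EuclideanSpace ℝ (Fin N))} (h1 : cellQ l ⊆ B)
    (h2 : B ⊆ {x | ∀ i, 0 ≤ x i ∧ x i ≤ l i}) : B =ᵐ[volume] cellQ l :=
  (h2.eventuallyLE.trans cellQ_ae_eq_Icc.symm.le).antisymm h1.eventuallyLE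

theorem fundamentalDomain_ae_eq_cellQ (hl : ∀ i, 0 < l i) :
    ZSpan.fundamentalDomain (cellBasis hl) =ᵐ[volume] cellQ l := by
  have key : ∀ x i, (cellBasis hl).repr x i ∈ Set.Ico (0 : ℝ) 1 ↔ 0 ≤ x i ∧ x i < l i := by
    intro x i
    rw [cellBasis_repr, Set.mem_Ico, inv_mul_lt_iff₀ (hl i), mul_one]
    exact and_congr_left fun _ => mul_nonneg_iff_of_pos_left (inv_pos.2 (hl i))
  refine ae_eq_cellQ_of_subset (fun x hx => ?_) (fun x hx i => ?_)
  · rw [ZSpan.mem_fundamentalDomain]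
    exact fun i => (key x i).2 ⟨(hx i).1.le, (hx i).2⟩
  · have := (key x i).1 ((ZSpan.mem_fundamentalDomain _).1 hx i)
    exact ⟨this.1, this.2.le⟩

theorem volume_cellQ_lt_top : volume (cellQ l) < ⊤ := by
  have h := (PiLp.volume_preserving_ofLp (Fin N)).measure_preimage
    (MeasurableSet.univ_pi fun i => (measurableSet_Ioo (a := (0 : ℝ)) (b := l i))).nullMeasurableSet
  have e : cellQ l = WithLp.ofLp ⁻¹' (Set.univ.pi fun i => Set.Ioo 0 (l i)) := by
    ext x; simp [cellQ]
  rw [e, h, Real.volume_pi_Ioo]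
  exact ENNReal.prod_lt_top fun i _ => ENNReal.ofReal_lt_top

/-- The dilated complements of the holes converge weakly to the volume fraction of `Q ∖ A`. -/
theorem tendsto_setIntegral_compl_holes (hl : ∀ i, 0 < l i) (hAQ : A ⊆ closure (cellQ l))
    (hA : MeasurableSet A) {f : EuclideanSpace ℝ (Fin N) → ℝ} (hf : Integrable f volume) :
    Tendsto (fun ε : ℝ => ∫ x in (holes l A ε)ᶜ, f x) (𝓝[>] 0)
      (𝓝 (volume.real (cellQ l \ A) / volume.real (cellQ l) * ∫ x, f x)) := by
  have h := tendsto_setIntegral_periodic (b := cellBasis hl) (S := (periodicExt l A)ᶜ)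
    (measurableSet_periodicExt hA).compl
    (fun g hg x => not_congr (periodicExt_periodic hl g hg x)) hf
  have hD := fundamentalDomain_ae_eq_cellQ hl
  have h1 : volume.real ((periodicExt l A)ᶜ ∩ ZSpan.fundamentalDomain (cellBasis hl))
      = volume.real (cellQ l \ A) := by
    have e : (periodicExt l A)ᶜ ∩ cellQ l = cellQ l \ A := by
      have := periodicExt_inter_cellQ hAQ
      rw [Set.inter_comm, ← Set.sdiff_eq, ← Set.sdiff_inter_self_eq_sdiff, this,
        Set.sdiff_inter_self_eq_sdiff]
    rw [← e]
    exact measureReal_congr ((ae_eq_refl _).inter hD)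
  rw [h1, measureReal_congr hD] at h
  refine h.congr' ?_
  filter_upwards [self_mem_nhdsWithin] with ε hε
  have hε0 : ε ≠ 0 := (Set.mem_Ioi.1 hε).ne'
  congr 2
  ext x
  simp [mem_holes_iff hε0]

theorem measurableSet_holes (hA : MeasurableSet A) {ε : ℝ} (hε : ε ≠ 0) :
    MeasurableSet (holes l A ε) := by
  have e : holes l A ε = (fun x => ε⁻¹ • x) ⁻¹' periodicExt l A := by
    ext x; exact mem_holes_iff hε
  rw [e]
  exact (measurableSet_periodicExt hA).preimage (measurable_const_smul _)

theorem holes_congr_ae {A' : Set (EuclideanSpace ℝ (Fin N))} (h : A' =ᵐ[volume] A) {ε : ℝ}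
    (hε : ε ≠ 0) : holes l A' ε =ᵐ[volume] holes l A ε := by
  have e : ∀ B : Set (EuclideanSpace ℝ (Fin N)),
      holes l B ε = (fun x => ε⁻¹ • x) ⁻¹' periodicExt l B := fun B => by
    ext x; exact mem_holes_iff hε
  rw [e, e]
  exact (Measure.quasiMeasurePreserving_smul volume (inv_ne_zero hε)).preimage_ae_eq
    (periodicExt_congr_ae h)

theorem perforated_ae_eq {Ω A' : Set (EuclideanSpace ℝ (Fin N))} (h : A' =ᵐ[volume] A) {ε : ℝ}
    (hε : ε ≠ 0) : Ω \ holes l A' ε =ᵐ[volume] perforated Ω l A ε := by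
  rw [perforated, Set.sdiff_self_inter]
  exact (ae_eq_refl Ω).diff (holes_congr_ae h hε)

/-- The volume fraction of `Q ∖ A` is one exactly when `A` is a null set. -/
theorem density_eq_one_iff (hAQ : A ⊆ closure (cellQ l)) (hA : MeasurableSet A)
    (hQ : 0 < volume.real (cellQ l)) :
    volume.real (cellQ l \ A) / volume.real (cellQ l) = 1 ↔ volume A = 0 := by
  have hAe : (A ∩ cellQ l : Set (EuclideanSpace ℝ (Fin N))) =ᵐ[volume] A := by
    have h1 : closure (cellQ l) =ᵐ[volume] cellQ l :=
      ae_eq_cellQ_of_subset subset_closure fun x hx i => mem_closure_cellQ hx i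
    have h2 : (A ∩ closure (cellQ l) : Set (EuclideanSpace ℝ (Fin N)))
        =ᵐ[volume] (A ∩ cellQ l : Set (EuclideanSpace ℝ (Fin N))) :=
      (ae_eq_refl A).inter h1
    rw [Set.inter_eq_left.2 hAQ] at h2
    exact h2.symm
  have hsum := measureReal_sdiff_add_inter (μ := volume) (s := cellQ l) hA volume_cellQ_lt_top.ne
  rw [div_eq_one_iff_eq hQ.ne']
  have hz : volume.real (cellQ l ∩ A) = 0 ↔ volume A = 0 := by
    rw [measureReal_eq_zero_iff ((measure_mono Set.inter_subset_left).trans_lt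
      volume_cellQ_lt_top).ne, Set.inter_comm, measure_congr hAe]
  rw [← hz]
  constructor <;> intro <;> linarith

end Holes

/-! ### Homogenization of the first eigenvalue -/

theorem corollary3p7 {N : ℕ} (J : EuclideanSpace ℝ (Fin N) → ℝ) (hJ : KernelH J)
    (Ω : Set (EuclideanSpace ℝ (Fin N))) (hΩo : IsOpen Ω) (hΩb : Bornology.IsBounded Ω)
    (hΩne : Ω.Nonempty)
    (l : Fin N → ℝ) (hl : ∀ i, 0 < l i)
    (A : Set (EuclideanSpace ℝ (Fin N))) (hAQ : A ⊆ closure (cellQ l))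
    (hAm : NullMeasurableSet A volume) (hQA : volume (cellQ l \ A) ≠ 0) :
    (∃ lamΩ : ℝ, IsFirstEigenvalueB J Ω lamΩ) ∧
    ∃ (lam : ℝ → ℝ) (β₁ : ℝ),
      (∀ᶠ ε in 𝓝[>] (0 : ℝ), IsFirstEigenvalueB J (perforated Ω l A ε) (lam ε)) ∧
      Tendsto lam (𝓝[>] (0 : ℝ)) (𝓝 β₁) ∧
      (IsFirstEigenvalueB J Ω β₁ ↔ volume A = 0) := by
  have hΩ := hΩo.measurableSet
  have hfin : volume Ω ≠ ⊤ := hΩb.measure_lt_top.ne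
  -- A measurable subset of `A` with null difference changes neither the densities nor, up to null
  -- sets, the perforated domains.
  obtain ⟨A', hA'A, hA', hAA'⟩ := hAm.exists_measurable_subset_ae_eq
  have hAQ' : A' ⊆ closure (cellQ l) := hA'A.trans hAQ
  have hQA' : volume (cellQ l \ A') ≠ 0 := by
    rwa [measure_congr ((ae_eq_refl (cellQ l)).diff hAA')]
  set θ := volume.real (cellQ l \ A') / volume.real (cellQ l) with hθdef
  have hQ0 : 0 < volume.real (cellQ l) :=
    ENNReal.toReal_pos (fun h => hQA' (measure_mono_null Set.sdiff_subset h)) volume_cellQ_lt_top.ne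
  have hθ : 0 < θ := div_pos (ENNReal.toReal_pos hQA'
    ((measure_mono Set.sdiff_subset).trans_lt volume_cellQ_lt_top).ne) hQ0
  obtain ⟨K, hKc, hK⟩ := hJ.exists_nonlocal_clm hΩ hfin
  have hKs := hJ.nonlocal_clm_symm hΩ hfin hK
  obtain ⟨v, hv⟩ := hJ.exists_nonlocal_form_pos hΩo hΩne hfin hK
  obtain ⟨μ, hμ, hμtop⟩ := exists_isTopEigenvalue K hKc hKs hv
  have hfirst := isFirstEigenvalueB_of_isTopEigenvalue hK hμ hμtop
  refine ⟨⟨_, hfirst⟩, ?_⟩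
  -- The index is restricted to positive `ε`, where dilation is invertible and the holes are
  -- measurable.
  have hE : ∀ ε : Set.Ioi (0 : ℝ), MeasurableSet (Ω \ holes l A' ε) := fun ε =>
    hΩ.diff (measurableSet_holes hA' (Set.mem_Ioi.1 ε.2).ne')
  choose P hP using fun ε => exists_indicator_clm (ν := volume) (hE ε)
  have hw : ∀ u v, Tendsto (fun ε => inner ℝ (P ε (K u)) (K v))
      (comap ((↑) : Set.Ioi (0 : ℝ) → ℝ) (𝓝[>] 0)) (𝓝 (θ * inner ℝ (K u) (K v))) := by
    intro u v
    have hint : Integrable (fun x => K u x * K v x) volume := by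
      simpa [mul_comm] using L2.integrable_inner (𝕜 := ℝ) (K u) (K v)
    have h1 := (tendsto_setIntegral_compl_holes hl hAQ' hA' hint).comp
      (tendsto_comap (f := ((↑) : Set.Ioi (0 : ℝ) → ℝ)))
    have h2 : ∫ x, K u x * K v x = inner ℝ (K u) (K v) := by
      rw [L2.inner_def]
      simp [mul_comm]
    rw [h2] at h1
    refine h1.congr fun ε => ?_
    have hHm := (measurableSet_holes (l := l) hA' (Set.mem_Ioi.1 ε.2).ne').compl
    rw [inner_indicator_clm (hE ε) (hP ε), Function.comp_apply, ← integral_indicator hHm,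
      ← integral_indicator (hE ε)]
    refine integral_congr_ae ?_
    -- Since `K u` vanishes off `Ω`, the integral over the complement of the holes reduces to `Ω`.
    filter_upwards [hK u] with x hx
    by_cases hxΩ : x ∈ Ω
    · by_cases hxh : x ∈ holes l A' ε <;> simp [hxΩ, hxh]
    · by_cases hxh : x ∈ holes l A' ε <;> simp [hxΩ, hxh, hx]
  obtain ⟨hex, hlim⟩ := eventually_exists_isTopEigenvalue hKc hKs
    (fun ε => indicator_clm_symm (hE ε) (hP ε)) (fun ε => indicator_clm_idem (hP ε)) hw hθ hμ hμtop
  choose ν hν using fun ε : Set.Ioi (0 : ℝ) =>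
    show ∃ ν, (∃ ν, 0 < ν ∧ IsTopEigenvalue (P ε ∘L K ∘L P ε) ν) →
      0 < ν ∧ IsTopEigenvalue (P ε ∘L K ∘L P ε) ν by
    by_cases h : ∃ ν, 0 < ν ∧ IsTopEigenvalue (P ε ∘L K ∘L P ε) ν
    · exact ⟨h.choose, fun _ => h.choose_spec⟩
    · exact ⟨0, fun h' => absurd h' h⟩
  have hνe : ∀ᶠ ε in comap ((↑) : Set.Ioi (0 : ℝ) → ℝ) (𝓝[>] 0),
      0 < ν ε ∧ IsTopEigenvalue (P ε ∘L K ∘L P ε) (ν ε) := hex.mono fun ε h => hν ε h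
  have hνlim := hlim ν hνe
  let lam : ℝ → ℝ := fun ε => if h : 0 < ε then 1 - ν ⟨ε, h⟩ else 0
  have hlam : ∀ ε : Set.Ioi (0 : ℝ), lam ε = 1 - ν ε := fun ε => by
    simp only [lam, dif_pos (Set.mem_Ioi.1 ε.2)]
  have hmap : map ((↑) : Set.Ioi (0 : ℝ) → ℝ) (comap (↑) (𝓝[>] (0 : ℝ))) = 𝓝[>] 0 := by
    rw [map_comap, Subtype.range_coe, inf_eq_left, le_principal_iff]
    exact self_mem_nhdsWithin
  refine ⟨lam, 1 - θ * μ, ?_, ?_, ?_⟩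
  · rw [← hmap, eventually_map]
    filter_upwards [hνe] with ε hε
    rw [hlam, ← isFirstEigenvalueB_congr_ae (perforated_ae_eq hAA' (Set.mem_Ioi.1 ε.2).ne')]
    exact isFirstEigenvalueB_of_isTopEigenvalue
      (compression_nonlocal_clm hΩ (hE ε) Set.sdiff_subset hK (hP ε)) hε.1 hε.2
  · rw [← hmap, tendsto_map'_iff]
    exact (hνlim.const_sub 1).congr fun ε => (hlam ε).symm
  · rw [← measure_congr hAA', ← density_eq_one_iff hAQ' hA' hQ0]
    constructor
    · intro h
      -- A least element is unique, so `β₁` being first on `Ω` forces `θ = 1`.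
      have h1 : 1 - θ * μ = 1 - μ := h.unique hfirst
      have h2 : θ * μ = 1 * μ := by linarith
      exact mul_right_cancel₀ hμ.ne' h2
    · intro h
      rw [hθdef, h, one_mul]
      exact hfirst
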